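/- **Theorem (characterization of distinguished subgroups).** Let $p$ be a prime number and $G$ a profinite group. Write $H^i(\cdot)=H^i(\cdot,\mathbb{Z}/p)$ for profinite cohomology with trivial action, so that $H^1(G)$ is the group of continuous homomorphisms $G\to\mathbb{Z}/p$, let $\cup$ be the cup product, and let $\beta_G\colon H^1(G)\to H^2(G)$ be the Bockstein homomorphism, i.e. the connecting homomorphism of $0\to\mathbb{Z}/p\to\mathbb{Z}/p^2\to\mathbb{Z}/p\to0$. Put $$\Omega(G)=H^1(G)\otimes_{\mathbb Z} H^1(G),\quad \Lambda_G(\alpha)=\cup\alpha\qquad (p=2),$$ $$\Omega(G)=\bigl(H^1(G)\otimes_{\mathbb Z} H^1(G)\bigr)\oplus H^1(G),\quad \Lambda_G(\alpha_1,\alpha_2)=\cup\alpha_1+\beta_G(\alpha_2)\qquad (p\neq2),$$ where $\Lambda_G\colon\Omega(G)\to H^2(G)$ and where $\cup\alpha$ is the image of $\alpha$ under the homomorphism $H^1(G)\otimes_{\mathbb Z} H^1(G)\to H^2(G)$ induced by the cup product. An element $\alpha\in\Omega(G)$ has *simple type*, with *kernel* $\ker\psi\cap\ker\psi'$, if there are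 $\psi,\psi'\in H^1(G)$ with $\alpha=\psi\otimes\psi'$ (for $p=2$), respectively $\alpha=(\psi\otimes\psi',\psi)$ (for $p\ne2$); the kernel may depend on the choice of $\psi,\psi'$. For an open normal subgroup $M$ of $G$ let $H^1(M)^G$ be the group of those $\varphi\in H^1(M)$ with $\varphi(g^{-1}mg)=\varphi(m)$ for all $g\in G$, $m\in M$, and let $\mathrm{trg}_{G/M}\colon H^1(M)^G\to H^2(G/M)$ be the transgression. A subgroup $N$ of $G$ is *distinguished* if there are an open normal subgroup $M$ of $G$, an element $\varphi\in H^1(M)^G$, and an element $\bar\alpha\in\Omega(G/M)$ of simple type with trivial kernel (that is, trivial for some choice of $\psi,\psi'\in H^1(G/M)$) such that $$\Lambda_{G/M}(\bar\alpha)=\mathrm{trg}_{G/M}(\varphi),\qquad N=\ker\varphi .$$ Let $N$ be a normal open subgroup of $G$. Then $N$ is distinguished if and only if 1. when $p=2$, the group $G/N$ is isomorphic to one of $1,\ \mathbb{Z}/2,\ (\mathbb{Z}/2)^2,\ \mathbb{Z}/4,\ D_4$, where $D_4$ is the dihedral group of order $8$; 2. when $p\neq2$, the group $G/N$ is isomorphic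 to one of $1,\ \mathbb{Z}/p,\ (\mathbb{Z}/p)^2,\ \mathbb{Z}/p^2,\ M_{p^3}$, where $M_{p^3}=\langle r,s\mid r^{p^2}=s^p=1,\ [r,s]=r^p\rangle$, with $[r,s]=r^{-1}s^{-1}rs$, is the nonabelian group of order $p^3$ and exponent $p^2$. -/

import Mathlib

open scoped TensorProduct

namespace ProfiniteCohomology

/-! Low-degree continuous cohomology of a topological group `G` with coefficients in `ZMod q`
(discrete, trivial action), through inhomogeneous continuous cochains. -/

section Cohomology

variable (q : ℕ) (G : Type*) [Group G] [TopologicalSpace G]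

/-- `H¹(G) = H¹(G, ℤ/q)`: the continuous homomorphisms `G → ℤ/q`. -/
def H1 : AddSubgroup (G → ZMod q) where
  carrier := {ψ | Continuous ψ ∧ ∀ σ τ, ψ (σ * τ) = ψ σ + ψ τ}
  add_mem' := by
    rintro a b ⟨ha, ha'⟩ ⟨hb, hb'⟩
    refine ⟨ha.add hb, fun σ τ => ?_⟩
    simp only [Pi.add_apply, ha', hb']
    ring
  zero_mem' := ⟨continuous_const, by simp⟩
  neg_mem' := by
    rintro a ⟨ha, ha'⟩
    refine ⟨ha.neg, fun σ τ => ?_⟩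
    simp only [Pi.neg_apply, ha']
    ring

/-- Continuous inhomogeneous `2`-cocycles `G × G → ℤ/q`. -/
def Z2 : AddSubgroup (G × G → ZMod q) where
  carrier := {f | Continuous f ∧
    ∀ σ τ ρ, f (τ, ρ) - f (σ * τ, ρ) + f (σ, τ * ρ) - f (σ, τ) = 0}
  add_mem' := by
    rintro a b ⟨ha, ha'⟩ ⟨hb, hb'⟩
    refine ⟨ha.add hb, fun σ τ ρ => ?_⟩
    simp only [Pi.add_apply]
    linear_combination ha' σ τ ρ + hb' σ τ ρ
  zero_mem' := ⟨continuous_const, by simp⟩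
  neg_mem' := by
    rintro a ⟨ha, ha'⟩
    refine ⟨ha.neg, fun σ τ ρ => ?_⟩
    simp only [Pi.neg_apply]
    linear_combination -ha' σ τ ρ

/-- `2`-coboundaries: `(∂u)(σ, τ) = u(σ) + u(τ) - u(στ)` with `u` a continuous `1`-cochain. -/
def B2 : AddSubgroup (G × G → ZMod q) where
  carrier := {f | ∃ u : G → ZMod q, Continuous u ∧ ∀ σ τ, f (σ, τ) = u σ + u τ - u (σ * τ)}
  add_mem' := by
    rintro a b ⟨u, hu, ha⟩ ⟨v, hv, hb⟩
    refine ⟨u + v, hu.add hv, fun σ τ => ?_⟩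
    simp only [Pi.add_apply, ha, hb]
    ring
  zero_mem' := ⟨0, continuous_const, by simp⟩
  neg_mem' := by
    rintro a ⟨u, hu, ha⟩
    refine ⟨-u, hu.neg, fun σ τ => ?_⟩
    simp only [Pi.neg_apply, ha]
    ring

/-- `H²(G) = H²(G, ℤ/q)`. -/
abbrev H2 : Type _ := Z2 q G ⧸ (B2 q G).addSubgroupOf (Z2 q G)

variable {q G}

/-- The class in `H²(G)` of a `2`-cocycle. -/
def H2mk : Z2 q G →+ H2 q G := QuotientAddGroup.mk' _

theorem H2mk_eq_iff (f g : Z2 q G) :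
    H2mk f = H2mk g ↔ ∃ u : G → ZMod q, Continuous u ∧
      ∀ σ τ, f.1 (σ, τ) = g.1 (σ, τ) + (u σ + u τ - u (σ * τ)) := by
  rw [eq_comm]
  unfold H2mk
  rw [QuotientAddGroup.mk'_apply, QuotientAddGroup.mk'_apply, QuotientAddGroup.eq,
    AddSubgroup.mem_addSubgroupOf]
  constructor
  · rintro ⟨u, hu, h⟩
    refine ⟨u, hu, fun σ τ => ?_⟩
    have := h σ τ
    simp only [AddSubgroup.coe_add, AddSubgroup.coe_neg, Pi.add_apply, Pi.neg_apply] at this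
    linear_combination this
  · rintro ⟨u, hu, h⟩
    refine ⟨u, hu, fun σ τ => ?_⟩
    simp only [AddSubgroup.coe_add, AddSubgroup.coe_neg, Pi.add_apply, Pi.neg_apply]
    linear_combination h σ τ

/-- The kernel of `ψ ∈ H¹(G)`. -/
def kerH1 (ψ : H1 q G) : Subgroup G where
  carrier := {σ | ψ.1 σ = 0}
  mul_mem' := by
    intro a b ha hb
    simp only [Set.mem_ofPred_eq] at ha hb ⊢
    rw [ψ.2.2, ha, hb, add_zero]
  one_mem' := by
    have h := ψ.2.2 1 1
    rw [mul_one] at h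
    exact left_eq_add.mp h
  inv_mem' := by
    intro a ha
    have h1 := ψ.2.2 1 1
    have h := ψ.2.2 a a⁻¹
    rw [mul_one] at h1
    simp only [Set.mem_ofPred_eq] at ha ⊢
    rw [mul_inv_cancel, left_eq_add.mp h1, ha, zero_add] at h
    exact h.symm

/-! ### Cup product `H¹(G) ⊗ H¹(G) → H²(G)` -/

/-- The `2`-cocycle `(σ, τ) ↦ ψ(σ) ψ'(τ)` representing `ψ ∪ ψ'`. -/
def cupCocycle (ψ ψ' : H1 q G) : Z2 q G :=
  ⟨fun x => ψ.1 x.1 * ψ'.1 x.2,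
    (ψ.2.1.comp continuous_fst).mul (ψ'.2.1.comp continuous_snd), fun σ τ ρ => by
      simp only [ψ.2.2, ψ'.2.2]
      ring⟩

/-- The homomorphism `H¹(G) ⊗ H¹(G) → H²(G)` induced by the cup product. -/
noncomputable def cup : (H1 q G ⊗[ℤ] H1 q G) →+ H2 q G :=
  (TensorProduct.lift (AddMonoidHom.toIntLinearMap
    (AddMonoidHom.mk' (fun ψ : H1 q G => AddMonoidHom.toIntLinearMap
        (AddMonoidHom.mk' (fun ψ' : H1 q G => H2mk (cupCocycle ψ ψ')) (fun a b => by
          rw [← map_add]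
          exact congrArg H2mk (Subtype.ext (funext fun x => mul_add _ _ _))))) (fun a b => by
        ext ψ'
        change H2mk (cupCocycle (a + b) ψ') = H2mk (cupCocycle a ψ') + H2mk (cupCocycle b ψ')
        rw [← map_add]
        exact congrArg H2mk (Subtype.ext (funext fun x => add_mul _ _ _)))))).toAddMonoidHom

theorem cup_tmul (ψ ψ' : H1 q G) : cup (ψ ⊗ₜ[ℤ] ψ') = H2mk (cupCocycle ψ ψ') := rfl

/-! ### The Bockstein homomorphism

`β_G : H¹(G, ℤ/q) → H²(G, ℤ/q)` is the connecting homomorphism of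
`0 → ℤ/q → ℤ/q² → ℤ/q → 0`.  With the set-theoretic lift `a ↦ a.val` of `ℤ/q` to `ℤ/q²`
(representatives in `{0, …, q - 1}`), the class `β_G(ψ)` is that of
`(σ, τ) ↦ (ψ(σ).val + ψ(τ).val - ψ(στ).val) / q`.  That any other lift gives the same
class is `bockstein_eq_of_lift`. -/

section Bockstein

variable [NeZero q]

/-- `(a.val + b.val - (a + b).val) / q`, an exact division. -/
def carry (a b : ZMod q) : ℤ := ((a.val : ℤ) + (b.val : ℤ) - ((a + b).val : ℤ)) / (q : ℤ)

theorem q_mul_carry (a b : ZMod q) :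
    (q : ℤ) * carry a b = (a.val : ℤ) + (b.val : ℤ) - ((a + b).val : ℤ) := by
  apply Int.mul_ediv_cancel'
  rw [← ZMod.intCast_zmod_eq_zero_iff_dvd]
  simp

theorem q_int_ne_zero : (q : ℤ) ≠ 0 := by exact_mod_cast NeZero.ne q

/-- The cocycle `(ψ̂(σ) + ψ̂(τ) - ψ̂(στ)) / q` for the lift `ψ̂ = ψ.val`. -/
def bocksteinCocycle (ψ : H1 q G) : Z2 q G :=
  ⟨fun x => (carry (ψ.1 x.1) (ψ.1 x.2) : ℤ), by
    refine ⟨?_, fun σ τ ρ => ?_⟩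
    · exact (continuous_of_discreteTopology
        (f := fun p : ZMod q × ZMod q => ((carry p.1 p.2 : ℤ) : ZMod q))).comp
        ((ψ.2.1.comp continuous_fst).prodMk (ψ.2.1.comp continuous_snd))
    · simp only [ψ.2.2]
      rw [← Int.cast_sub, ← Int.cast_add, ← Int.cast_sub]
      convert Int.cast_zero
      apply mul_left_cancel₀ (q_int_ne_zero (q := q))
      have h1 := q_mul_carry (ψ.1 τ) (ψ.1 ρ)
      have h2 := q_mul_carry (ψ.1 σ + ψ.1 τ) (ψ.1 ρ)
      have h3 := q_mul_carry (ψ.1 σ) (ψ.1 τ + ψ.1 ρ)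
      have h4 := q_mul_carry (ψ.1 σ) (ψ.1 τ)
      rw [← add_assoc] at h3
      linear_combination h1 - h2 + h3 - h4⟩

/-- The Bockstein homomorphism `β_G : H¹(G) → H²(G)`. -/
def bockstein : H1 q G →+ H2 q G :=
  AddMonoidHom.mk' (fun ψ => H2mk (bocksteinCocycle ψ)) (fun a b => by
    rw [← map_add, H2mk_eq_iff]
    refine ⟨fun σ => -((carry (a.1 σ) (b.1 σ) : ℤ) : ZMod q), ?_, fun σ τ => ?_⟩
    · exact ((continuous_of_discreteTopology
        (f := fun p : ZMod q × ZMod q => ((carry p.1 p.2 : ℤ) : ZMod q))).comp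
        (a.2.1.prodMk b.2.1)).neg
    · change ((carry (a.1 σ + b.1 σ) (a.1 τ + b.1 τ) : ℤ) : ZMod q) =
        ((carry (a.1 σ) (a.1 τ) : ℤ) : ZMod q) + ((carry (b.1 σ) (b.1 τ) : ℤ) : ZMod q) + _
      simp only [a.2.2, b.2.2, ← Int.cast_add, ← Int.cast_neg, ← Int.cast_sub]
      congr 1
      apply mul_left_cancel₀ (q_int_ne_zero (q := q))
      have h1 := q_mul_carry (a.1 σ + b.1 σ) (a.1 τ + b.1 τ)
      have h2 := q_mul_carry (a.1 σ) (a.1 τ)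
      have h3 := q_mul_carry (b.1 σ) (b.1 τ)
      have h4 := q_mul_carry (a.1 σ) (b.1 σ)
      have h5 := q_mul_carry (a.1 τ) (b.1 τ)
      have h6 := q_mul_carry (a.1 σ + a.1 τ) (b.1 σ + b.1 τ)
      have e : a.1 σ + b.1 σ + (a.1 τ + b.1 τ) = a.1 σ + a.1 τ + (b.1 σ + b.1 τ) := by ring
      rw [e] at h1
      linear_combination h1 - h2 - h3 + h4 + h5 - h6)

/-- `β_G` is the connecting homomorphism: it can be computed from any continuous lift `ψ̂` of
`ψ` to `ℤ/q²`, where `ℤ/q → ℤ/q²` is `i ↦ q i`. -/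
theorem bockstein_eq_of_lift (ψ : H1 q G) (ψhat : G → ZMod (q ^ 2)) (hc : Continuous ψhat)
    (hlift : ∀ σ, ZMod.castHom (dvd_pow_self q two_ne_zero) (ZMod q) (ψhat σ) = ψ.1 σ)
    (f : Z2 q G)
    (hf : ∀ σ τ, (q : ZMod (q ^ 2)) * ((f.1 (σ, τ)).val : ZMod (q ^ 2)) =
      ψhat σ + ψhat τ - ψhat (σ * τ)) :
    bockstein ψ = H2mk f := by
  have hq : (q : ℤ) ≠ 0 := q_int_ne_zero
  have : NeZero (q ^ 2) := ⟨pow_ne_zero 2 (NeZero.ne q)⟩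
  let e : ZMod (q ^ 2) → ℤ := fun z =>
    ((z.val : ℤ) - ((ZMod.castHom (dvd_pow_self q two_ne_zero) (ZMod q) z).val : ℤ)) / (q : ℤ)
  have he : ∀ σ, (q : ℤ) * e (ψhat σ) = ((ψhat σ).val : ℤ) - ((ψ.1 σ).val : ℤ) := by
    intro σ
    have : (q : ℤ) ∣ ((ψhat σ).val : ℤ) - ((ψ.1 σ).val : ℤ) := by
      rw [← ZMod.intCast_zmod_eq_zero_iff_dvd, ← hlift σ]
      simp
    simp only [e, hlift]
    exact Int.mul_ediv_cancel' this
  change H2mk (bocksteinCocycle ψ) = H2mk f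
  rw [H2mk_eq_iff]
  refine ⟨fun σ => -((e (ψhat σ) : ℤ) : ZMod q), ?_, fun σ τ => ?_⟩
  · exact ((continuous_of_discreteTopology
      (f := fun z : ZMod (q ^ 2) => ((e z : ℤ) : ZMod q))).comp hc).neg
  · change ((carry (ψ.1 σ) (ψ.1 τ) : ℤ) : ZMod q) = _
    have h := hf σ τ
    have h0 : ((q * ((f.1 (σ, τ)).val : ℤ) - (((ψhat σ).val : ℤ) + ((ψhat τ).val : ℤ)
        - ((ψhat (σ * τ)).val : ℤ)) : ℤ) : ZMod (q ^ 2)) = 0 := by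
      push_cast
      simp only [ZMod.natCast_val, ZMod.cast_id', id]
      rw [sub_eq_zero, ← h, ZMod.natCast_val]
    rw [ZMod.intCast_zmod_eq_zero_iff_dvd] at h0
    obtain ⟨k, hk⟩ := h0
    have key : carry (ψ.1 σ) (ψ.1 τ) = ((f.1 (σ, τ)).val : ℤ)
        - e (ψhat σ) - e (ψhat τ) + e (ψhat (σ * τ)) - q * k := by
      apply mul_left_cancel₀ hq
      have h1 := q_mul_carry (ψ.1 σ) (ψ.1 τ)
      rw [← ψ.2.2] at h1
      have h2 := he σ
      have h3 := he τ
      have h4 := he (σ * τ)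
      push_cast at hk
      linear_combination h1 - hk + h2 + h3 - h4
    rw [key]
    push_cast
    simp
    ring

end Bockstein

end Cohomology

/-! ### Invariant classes and the transgression -/

section Transgression

variable (q : ℕ) {G : Type*} [Group G] [TopologicalSpace G]

/-- `H¹(M)^G`: the `φ ∈ H¹(M)` with `φ(g⁻¹ m g) = φ(m)` for all `g ∈ G`, `m ∈ M`. -/
def invariantH1 (M : Subgroup G) [hM : M.Normal] : AddSubgroup (H1 q M) where
  carrier := {φ | ∀ (g : G) (m : M),
    φ.1 ⟨g⁻¹ * m * g, by simpa using hM.conj_mem m m.2 g⁻¹⟩ = φ.1 m}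
  add_mem' := by
    intro a b ha hb g m
    exact congrArg₂ (· + ·) (ha g m) (hb g m)
  zero_mem' := fun _ _ => rfl
  neg_mem' := by
    intro a ha g m
    exact congrArg (- ·) (ha g m)

variable {q}

/-- `c ∈ Z²(G/M)` and `y : G → ℤ/q` exhibit the transgression of `φ`: `y` is a continuous
`1`-cochain on `G` extending `φ`, and `∂y` is the inflation of `c`. -/
def IsTransgressionCocycle {M : Subgroup G} [M.Normal] (φ : invariantH1 q M)
    (c : Z2 q (G ⧸ M)) (y : G → ZMod q) : Prop :=
  Continuous y ∧ (∀ m : M, y m = φ.1.1 m) ∧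
    ∀ σ τ : G, c.1 ((σ : G ⧸ M), (τ : G ⧸ M)) = y σ + y τ - y (σ * τ)

theorem exists_isTransgressionCocycle [IsTopologicalGroup G] {M : Subgroup G} [hN : M.Normal]
    (hM : IsOpen (M : Set G)) (φ : invariantH1 q M) :
    ∃ c y, IsTransgressionCocycle φ c y := by
  classical
  have : DiscreteTopology (G ⧸ M) := QuotientGroup.discreteTopology hM
  -- a normalized section
  let s : G ⧸ M → G := fun a => if a = 1 then 1 else a.out
  have hs1 : s 1 = 1 := by simp [s]
  have hs : ∀ a, (s a : G ⧸ M) = a := by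
    intro a
    by_cases h : a = 1
    · simp [s, h]
    · simp [s, h]
  have hmem : ∀ σ : G, (s (σ : G ⧸ M))⁻¹ * σ ∈ M := by
    intro σ
    rw [← QuotientGroup.eq]
    exact hs _
  let y : G → ZMod q := fun σ => φ.1.1 ⟨(s (σ : G ⧸ M))⁻¹ * σ, hmem σ⟩
  have hyc : Continuous y := by
    refine φ.1.2.1.comp (Continuous.subtype_mk ?_ _)
    refine Continuous.mul ?_ continuous_id
    exact (continuous_of_discreteTopology (f := s)).comp QuotientGroup.continuous_mk |>.inv
  have hyM : ∀ m : M, y m = φ.1.1 m := by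
    intro m
    have h1 : ((m : G) : G ⧸ M) = 1 := (QuotientGroup.eq_one_iff _).2 m.2
    have : (⟨(s ((m : G) : G ⧸ M))⁻¹ * m, hmem m⟩ : M) = m := by
      ext
      simp [h1, hs1]
    simp only [y, this]
  have hyr : ∀ (σ : G) (m : M), y (σ * m) = y σ + φ.1.1 m := by
    intro σ m
    have h1 : ((σ * (m : G) : G) : G ⧸ M) = (σ : G ⧸ M) := by
      rw [QuotientGroup.mk_mul, (QuotientGroup.eq_one_iff _).2 m.2, mul_one]
    have : (⟨(s ((σ * (m : G) : G) : G ⧸ M))⁻¹ * (σ * m), hmem _⟩ : M) =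
        ⟨(s (σ : G ⧸ M))⁻¹ * σ, hmem σ⟩ * m := by
      ext
      simp [h1, mul_assoc]
    simp only [y, this, φ.1.2.2]
  have hconj : ∀ (σ : G) (m : M), y (m * σ) = y σ + φ.1.1 m := by
    intro σ m
    have h := φ.2 σ m
    rw [← h, ← hyr]
    congr 1
    simp [mul_assoc]
  let c : (G ⧸ M) × (G ⧸ M) → ZMod q := fun x => y (s x.1) + y (s x.2) - y (s x.1 * s x.2)
  have hc : ∀ σ τ : G, c ((σ : G ⧸ M), (τ : G ⧸ M)) = y σ + y τ - y (σ * τ) := by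
    intro σ τ
    obtain ⟨m, hm⟩ : ∃ m : M, σ = s (σ : G ⧸ M) * m := ⟨⟨_, hmem σ⟩, by simp⟩
    obtain ⟨n, hn⟩ : ∃ n : M, τ = s (τ : G ⧸ M) * n := ⟨⟨_, hmem τ⟩, by simp⟩
    simp only [c]
    generalize s (σ : G ⧸ M) = a at *
    generalize s (τ : G ⧸ M) = b at *
    subst hm hn
    have e : a * m * (b * n) = a * b * ((⟨b⁻¹ * m * b, by
        simpa using hN.conj_mem m m.2 b⁻¹⟩ : M) * n : M) := by
      simp [mul_assoc]
    rw [e, hyr, hyr, hyr, φ.1.2.2, φ.2 b m]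
    ring
  refine ⟨⟨c, continuous_of_discreteTopology, ?_⟩, y, hyc, hyM, hc⟩
  intro a b d
  obtain ⟨σ, rfl⟩ := QuotientGroup.mk_surjective a
  obtain ⟨τ, rfl⟩ := QuotientGroup.mk_surjective b
  obtain ⟨ρ, rfl⟩ := QuotientGroup.mk_surjective d
  rw [← QuotientGroup.mk_mul, ← QuotientGroup.mk_mul, hc, hc, hc, hc, mul_assoc]
  ring

theorem transgressionCocycle_unique [IsTopologicalGroup G] {M : Subgroup G} [M.Normal]
    (hM : IsOpen (M : Set G)) {φ : invariantH1 q M} {c c' : Z2 q (G ⧸ M)} {y y' : G → ZMod q}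
    (h : IsTransgressionCocycle φ c y) (h' : IsTransgressionCocycle φ c' y') :
    H2mk c = H2mk c' := by
  have : DiscreteTopology (G ⧸ M) := QuotientGroup.discreteTopology hM
  obtain ⟨-, h2, h3⟩ := h
  obtain ⟨-, h2', h3'⟩ := h'
  have y1 : y 1 = y' 1 := (h2 1).trans (h2' 1).symm
  have key : ∀ (σ : G) (m : M), y (σ * m) - y' (σ * m) = y σ - y' σ := by
    intro σ m
    have e : ((m : G) : G ⧸ M) = ((1 : G) : G ⧸ M) := (QuotientGroup.eq_one_iff _).2 m.2
    have a1 := h3 σ m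
    have a2 := h3 σ 1
    have a3 := h3' σ m
    have a4 := h3' σ 1
    rw [e] at a1 a3
    rw [mul_one] at a2 a4
    have b1 := h2 m
    have b2 := h2' m
    linear_combination a1 - a2 - a3 + a4 + b1 - b2 - y1
  rw [H2mk_eq_iff]
  let u : G ⧸ M → ZMod q := fun a => y a.out - y' a.out
  have hu : ∀ σ : G, u (σ : G ⧸ M) = y σ - y' σ := by
    intro σ
    obtain ⟨m, hm⟩ := QuotientGroup.mk_out_eq_mul M σ
    simp only [u, hm, key]
  refine ⟨u, continuous_of_discreteTopology, fun a b => ?_⟩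
  obtain ⟨σ, rfl⟩ := QuotientGroup.mk_surjective a
  obtain ⟨τ, rfl⟩ := QuotientGroup.mk_surjective b
  rw [← QuotientGroup.mk_mul, hu, hu, hu, h3, h3']
  ring

/-- The transgression `trg_{G/M} : H¹(M)^G → H²(G/M)` for an open normal subgroup `M`: extend
`φ` to a continuous `1`-cochain `y` on `G` such that `∂y` comes from a `2`-cocycle of `G/M`;
the class of that cocycle is `trg φ` (by `transgressionCocycle_unique` it is independent of
the choice of `y`). -/
noncomputable def transgression [IsTopologicalGroup G] (M : Subgroup G) [M.Normal]
    (hM : IsOpen (M : Set G)) : invariantH1 q M →+ H2 q (G ⧸ M) :=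
  AddMonoidHom.mk' (fun φ => H2mk (exists_isTransgressionCocycle hM φ).choose) (fun φ φ' => by
    rw [← map_add]
    obtain ⟨y, h1, h2, h3⟩ := (exists_isTransgressionCocycle hM φ).choose_spec
    obtain ⟨y', h1', h2', h3'⟩ := (exists_isTransgressionCocycle hM φ').choose_spec
    obtain ⟨z, hz⟩ := (exists_isTransgressionCocycle hM (φ + φ')).choose_spec
    refine transgressionCocycle_unique hM hz (y' := y + y') ⟨h1.add h1', fun m => ?_,
      fun σ τ => ?_⟩
    · exact congrArg₂ (· + ·) (h2 m) (h2' m)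
    · refine (congrArg₂ (· + ·) (h3 σ τ) (h3' σ τ)).trans ?_
      simp only [Pi.add_apply]
      ring)

theorem transgression_eq [IsTopologicalGroup G] {M : Subgroup G} [M.Normal]
    (hM : IsOpen (M : Set G)) {φ : invariantH1 q M} {c : Z2 q (G ⧸ M)} {y : G → ZMod q}
    (h : IsTransgressionCocycle φ c y) : transgression M hM φ = H2mk c := by
  obtain ⟨z, hz⟩ := (exists_isTransgressionCocycle hM φ).choose_spec
  exact transgressionCocycle_unique hM hz h

end Transgression

/-! ### The group `Ω(G)`, elements of simple type, distinguished subgroups -/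

section Distinguished

variable (q : ℕ) (G : Type*) [Group G] [TopologicalSpace G]

/-- `Ω(G)` is `H¹(G) ⊗ H¹(G)` if `q = 2` and `(H¹(G) ⊗ H¹(G)) ⊕ H¹(G)` if `q ≠ 2`.
Both cases are realized inside the latter group: for `q = 2` the second component is `0`. -/
def Omega : AddSubgroup ((H1 q G ⊗[ℤ] H1 q G) × H1 q G) where
  carrier := {α | q = 2 → α.2 = 0}
  add_mem' := by
    intro a b ha hb h
    simp [ha h, hb h]
  zero_mem' := fun _ => rfl
  neg_mem' := by
    intro a ha h
    simp [ha h]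

variable {q G}

/-- `Λ_G : Ω(G) → H²(G)`, `Λ_G(α) = ∪α` if `q = 2` and `Λ_G(α₁, α₂) = ∪α₁ + β_G(α₂)` if
`q ≠ 2` (for `q = 2` one has `α₂ = 0`, so that the second formula covers both cases). -/
noncomputable def Lam [NeZero q] : Omega q G →+ H2 q G :=
  AddMonoidHom.mk' (fun α => cup α.1.1 + bockstein α.1.2) (fun a b => by
    simp only [AddSubgroup.coe_add, Prod.fst_add, Prod.snd_add, map_add]
    abel)

/-- The element of `Ω(G)` of simple type attached to `ψ, ψ' ∈ H¹(G)`: it is `ψ ⊗ ψ'` if `q = 2`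
and `(ψ ⊗ ψ', ψ)` if `q ≠ 2`. -/
noncomputable def simpleElement (ψ ψ' : H1 q G) : Omega q G :=
  ⟨(ψ ⊗ₜ[ℤ] ψ', if q = 2 then 0 else ψ), fun h => by simp [h]⟩

/-- `α` has simple type and `K` is a kernel of `α`. -/
def IsSimpleWithKernel (α : Omega q G) (K : Subgroup G) : Prop :=
  ∃ ψ ψ' : H1 q G, α = simpleElement ψ ψ' ∧ K = kerH1 ψ ⊓ kerH1 ψ'

/-- `N` is a distinguished subgroup of `G`: there are an open (normal) subgroup `M` of `G`,
`φ ∈ H¹(M)^G` and `α ∈ Ω(G/M)` of simple type with trivial kernel such that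
`Λ_{G/M}(α) = trg_{G/M}(φ)` and `N = Ker φ`. -/
def IsDistinguished (q : ℕ) [NeZero q] {G : Type*} [Group G] [TopologicalSpace G]
    [IsTopologicalGroup G] (N : Subgroup G) : Prop :=
  ∃ (M : Subgroup G) (_ : M.Normal) (hM : IsOpen (M : Set G))
    (φ : invariantH1 q M) (α : Omega q (G ⧸ M)),
    IsSimpleWithKernel α ⊥ ∧ Lam α = transgression M hM φ ∧ N = (kerH1 φ.1).map M.subtype

end Distinguished

/-! ### The modular group -/

/-- The relators of `M_{p³}`: `r^{p²}`, `s^p`, `[r, s] r^{-p}`, with `r`, `s` the generators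
`0`, `1` and `[r, s] = r⁻¹ s⁻¹ r s`. -/
def modularRels (p : ℕ) : Set (FreeGroup (Fin 2)) :=
  {FreeGroup.of 0 ^ (p ^ 2), FreeGroup.of 1 ^ p,
    ((FreeGroup.of 0)⁻¹ * (FreeGroup.of 1)⁻¹ * FreeGroup.of 0 * FreeGroup.of 1)
      * (FreeGroup.of 0 ^ p)⁻¹}

/-- `M_{p³} = ⟨r, s | r^{p²} = s^p = 1, [r, s] = r^p⟩`. -/
abbrev ModularGroup (p : ℕ) : Type := PresentedGroup (modularRels p)

end ProfiniteCohomology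

/-! Both halves of the equation `Lam α = transgression M hM φ` are classes of explicit cocycles, so
the equation can be read as the existence of a homomorphism. If `α` comes from `ψ, ψ'`, then `Lam α`
is the pullback along `(ψ, ψ')` of one universal cocycle `simpleCocycle p` on `(ℤ/p)²`. Inflated to
`G`, the transgression becomes the coboundary of a cochain extending `φ`. The equation therefore
says that the pulled-back cocycle is a coboundary `∂z` on `G`, i.e. that `(ψ, ψ', z)` is a
homomorphism from `G` to a central extension `E` of `(ℤ/p)²` by `ℤ/p` (`SimpleExtension p`).
Triviality of the kernel of `α` makes `M` the preimage of the central `ℤ/p`. There `z` equals `φ`,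
so the kernel of the homomorphism is `ker φ = N`. The construction can be reversed
(`isDistinguished_ker`), and an open normal `N` is distinguished iff `G/N` embeds in `E`
(`isDistinguished_iff_exists_injective`).

It remains to list the subgroups of `E`, a group of order `p³`
(`exists_injective_simpleExtension_iff`). Orders `1`, `p`, `p²` leave only the trivial group, `ℤ/p`,
`(ℤ/p)²` and `ℤ/p²`. All of these occur, because `E` contains a copy of `(ℤ/p)²` and an element of
order `p²`. Finally `E` is `D₄` for `p = 2` and `M_{p³}` for `p ≠ 2`. -/

namespace ProfiniteCohomology

/-! ### The universal cocycle on `(ℤ/p)²` -/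

/-- The cocycle `(x, x') ↦ x₁ x'₂ + β(x₁, x'₁)` on `(ℤ/p)²`, without the Bockstein term `β`
if `p = 2`. -/
def simpleCocycle (p : ℕ) [NeZero p] (x x' : ZMod p × ZMod p) : ZMod p :=
  x.1 * x'.2 + if p = 2 then 0 else ((carry x.1 x'.1 : ℤ) : ZMod p)

section

variable {p : ℕ} [NeZero p]

theorem carry_zero_left (a : ZMod p) : carry 0 a = 0 := by simp [carry]

theorem carry_zero_right (a : ZMod p) : carry a 0 = 0 := by simp [carry]

/-- Over `ℤ`, `p * carry` is the coboundary of `ZMod.val`, and the factor `p` can be cancelled. -/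
theorem carry_cocycle (a b c : ZMod p) :
    carry b c - carry (a + b) c + carry a (b + c) - carry a b = 0 := by
  apply mul_left_cancel₀ (q_int_ne_zero (q := p))
  have h1 := q_mul_carry b c
  have h2 := q_mul_carry (a + b) c
  have h3 := q_mul_carry a (b + c)
  have h4 := q_mul_carry a b
  rw [← add_assoc] at h3
  linear_combination h1 - h2 + h3 - h4

theorem simpleCocycle_zero_left (x : ZMod p × ZMod p) : simpleCocycle p 0 x = 0 := by
  simp [simpleCocycle, carry_zero_left]

theorem simpleCocycle_zero_right (x : ZMod p × ZMod p) : simpleCocycle p x 0 = 0 := by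
  simp [simpleCocycle, carry_zero_right]

theorem simpleCocycle_cocycle (x y z : ZMod p × ZMod p) :
    simpleCocycle p y z - simpleCocycle p (x + y) z + simpleCocycle p x (y + z)
      - simpleCocycle p x y = 0 := by
  have h := congrArg (Int.cast : ℤ → ZMod p) (carry_cocycle x.1 y.1 z.1)
  push_cast at h
  unfold simpleCocycle
  split_ifs
  · simp only [Prod.fst_add, Prod.snd_add]
    ring
  · simp only [Prod.fst_add, Prod.snd_add]
    linear_combination h

end

/-! ### The central extension and its elements of order `p²` -/

/-- The central extension of `(ℤ/p)²` by `ℤ/p` attached to `-simpleCocycle p`. -/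
@[ext]
structure SimpleExtension (p : ℕ) where
  /-- The image in `(ℤ/p)²`. -/
  base : ZMod p × ZMod p
  /-- The coordinate in the central subgroup `ℤ/p`. -/
  fibre : ZMod p
deriving DecidableEq

namespace SimpleExtension

variable {p : ℕ}

/-- The underlying type of `SimpleExtension p`. -/
def equivProd : SimpleExtension p ≃ (ZMod p × ZMod p) × ZMod p where
  toFun x := (x.base, x.fibre)
  invFun x := ⟨x.1, x.2⟩

theorem card_eq : Nat.card (SimpleExtension p) = p ^ 3 := by
  rw [Nat.card_congr equivProd, Nat.card_prod, Nat.card_prod, Nat.card_zmod]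
  ring

instance : One (SimpleExtension p) := ⟨⟨0, 0⟩⟩

@[simp] theorem base_one : (1 : SimpleExtension p).base = 0 := rfl

@[simp] theorem fibre_one : (1 : SimpleExtension p).fibre = 0 := rfl

variable [NeZero p]

instance : Fintype (SimpleExtension p) := Fintype.ofEquiv _ equivProd.symm

instance : Mul (SimpleExtension p) where
  mul x y := ⟨x.base + y.base, x.fibre + y.fibre - simpleCocycle p x.base y.base⟩

instance : Inv (SimpleExtension p) where
  inv x := ⟨-x.base, -x.fibre + simpleCocycle p (-x.base) x.base⟩

@[simp] theorem base_mul (x y : SimpleExtension p) : (x * y).base = x.base + y.base := rfl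

@[simp] theorem fibre_mul (x y : SimpleExtension p) :
    (x * y).fibre = x.fibre + y.fibre - simpleCocycle p x.base y.base := rfl

theorem base_inv (x : SimpleExtension p) : (x⁻¹).base = -x.base := rfl

theorem fibre_inv (x : SimpleExtension p) :
    (x⁻¹).fibre = -x.fibre + simpleCocycle p (-x.base) x.base := rfl

instance : Group (SimpleExtension p) :=
  Group.ofLeftAxioms
    (fun x y z => by
      ext1
      · simp [add_assoc]
      · simp only [fibre_mul, base_mul]
        linear_combination simpleCocycle_cocycle x.base y.base z.base)
    (fun x => by ext1 <;> simp [simpleCocycle_zero_left])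
    (fun x => by ext1 <;> simp [base_inv, fibre_inv])

/-- The cocycle is normalized, so the fibre over `0` is central. This is what makes the character
built in `isDistinguished_ker` invariant under `G`. -/
theorem mul_comm_of_base_eq_zero {x : SimpleExtension p} (hx : x.base = 0)
    (y : SimpleExtension p) : x * y = y * x := by
  ext1 <;> simp [hx, simpleCocycle_zero_left, simpleCocycle_zero_right, add_comm]

/-- The projection to `(ℤ/p)²`. -/
def baseHom : SimpleExtension p →* Multiplicative (ZMod p × ZMod p) where
  toFun x := Multiplicative.ofAdd x.base
  map_one' := rfl
  map_mul' _ _ := rfl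

/-- The elements of base `(0, b)` form a subgroup isomorphic to `(ℤ/p)²`. -/
def ofProd : Multiplicative (ZMod p × ZMod p) →* SimpleExtension p where
  toFun x := ⟨(0, x.toAdd.1), x.toAdd.2⟩
  map_one' := rfl
  map_mul' x y := by ext1 <;> simp [simpleCocycle, carry_zero_left]

theorem ofProd_injective : Function.Injective (ofProd (p := p)) := by
  intro x y h
  have h1 := congrArg (fun z => z.base.2) h
  have h2 := congrArg (fun z => z.fibre) h
  exact Prod.ext h1 h2

/-- Adding `1` to `k` produces a carry exactly when the quotient by `p` jumps. -/
theorem carry_natCast_one (hp : 1 < p) (k : ℕ) :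
    carry (k : ZMod p) 1 = ((k + 1) / p : ℕ) - (k / p : ℕ) := by
  apply mul_left_cancel₀ (q_int_ne_zero (q := p))
  have : Fact (1 < p) := ⟨hp⟩
  have h := q_mul_carry (k : ZMod p) 1
  rw [← Nat.cast_succ, ZMod.val_natCast, ZMod.val_natCast, ZMod.val_one] at h
  have h1 : ((p * (k / p) + k % p : ℕ) : ℤ) = k := by rw [Nat.div_add_mod]
  have h2 : ((p * ((k + 1) / p) + (k + 1) % p : ℕ) : ℤ) = (k + 1 : ℕ) := by rw [Nat.div_add_mod]
  push_cast at h h1 h2 ⊢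
  linear_combination h + h1 - h2

/-- The cup term vanishes on the powers of this element, so the fibre just counts, with a minus
sign, the carries met on the way to `k`. The Bockstein term is needed, hence `p ≠ 2`. -/
theorem pow_first (hp : 1 < p) (hp2 : p ≠ 2) (k : ℕ) :
    (⟨(1, 0), 0⟩ : SimpleExtension p) ^ k = ⟨(k, 0), -((k / p : ℕ) : ZMod p)⟩ := by
  induction k with
  | zero => simp [SimpleExtension.ext_iff, Prod.ext_iff]
  | succ k ih =>
    rw [pow_succ, ih]
    ext1
    · simp
    · simp [-Nat.cast_div, -Int.natCast_ediv, simpleCocycle, hp2, carry_natCast_one hp]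
      ring

theorem pow_first_self (hp : 1 < p) (hp2 : p ≠ 2) :
    (⟨(1, 0), 0⟩ : SimpleExtension p) ^ p = ⟨0, -1⟩ := by
  rw [pow_first hp hp2]
  ext1
  · simp
  · simp [Nat.div_self (zero_lt_one.trans hp)]

theorem pow_of_base_eq_zero {x : SimpleExtension p} (hx : x.base = 0) (k : ℕ) :
    x ^ k = ⟨0, k * x.fibre⟩ := by
  induction k with
  | zero => ext1 <;> simp
  | succ k ih =>
    rw [pow_succ, ih]
    ext1 <;> simp [hx, simpleCocycle_zero_left, add_mul]

/-- Without the Bockstein term, a nontrivial square has to come from the cup term, so both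
coordinates of the base must be nonzero. -/
theorem sq_of_two : (⟨(1, 1), 0⟩ : SimpleExtension 2) ^ 2 = ⟨0, -1⟩ := by decide

theorem base_pow (x : SimpleExtension p) (k : ℕ) : (x ^ k).base = k • x.base := by
  induction k with
  | zero => simp
  | succ k ih => rw [pow_succ, base_mul, ih, succ_nsmul]

theorem exists_orderOf_eq (p : ℕ) [hp : Fact p.Prime] :
    ∃ x : SimpleExtension p, orderOf x = p ^ 2 := by
  -- It suffices that `x ^ p` generates the central subgroup of order `p`.
  obtain ⟨x, hx⟩ : ∃ x : SimpleExtension p, x ^ p = ⟨0, -1⟩ := by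
    by_cases h2 : p = 2
    · subst h2
      exact ⟨_, sq_of_two⟩
    · exact ⟨_, pow_first_self hp.out.one_lt h2⟩
  refine ⟨x, orderOf_eq_prime_pow ?_ ?_⟩
  · rw [pow_one, hx]
    intro h
    simpa using congrArg fibre h
  · rw [pow_succ, pow_one, pow_mul, hx, pow_of_base_eq_zero rfl]
    ext1 <;> simp

end SimpleExtension

/-! ### Distinguished subgroups as kernels of homomorphisms to the extension -/

theorem Lam_simpleElement {p : ℕ} [NeZero p] {Q : Type*} [Group Q] [TopologicalSpace Q]
    (ψ ψ' : H1 p Q) :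
    Lam (simpleElement ψ ψ') =
      H2mk (cupCocycle ψ ψ' + if p = 2 then 0 else bocksteinCocycle ψ) := by
  rw [map_add]
  change cup (ψ ⊗ₜ[ℤ] ψ') + bockstein (if p = 2 then 0 else ψ) = _
  rw [cup_tmul]
  split_ifs
  · simp
  · rfl

theorem cupCocycle_add_bocksteinCocycle_apply {p : ℕ} [NeZero p] {Q : Type*} [Group Q]
    [TopologicalSpace Q] (ψ ψ' : H1 p Q) (a b : Q) :
    (cupCocycle ψ ψ' + if p = 2 then 0 else bocksteinCocycle ψ).1 (a, b) =
      simpleCocycle p (ψ.1 a, ψ'.1 a) (ψ.1 b, ψ'.1 b) := by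
  unfold simpleCocycle
  split_ifs <;> rfl

theorem H1_map_one {q : ℕ} {Q : Type*} [Group Q] [TopologicalSpace Q] (ψ : H1 q Q) :
    ψ.1 1 = 0 :=
  (kerH1 ψ).one_mem

section

variable {p : ℕ} [NeZero p] {G : Type*} [Group G] [TopologicalSpace G] [IsTopologicalGroup G]

theorem IsDistinguished.exists_hom {N : Subgroup G} (h : IsDistinguished p N) :
    ∃ f : G →* SimpleExtension p, f.ker = N := by
  obtain ⟨M, _, hM, φ, _, ⟨ψ, ψ', rfl, hK⟩, hΛ, rfl⟩ := h
  obtain ⟨c, y, hc⟩ := exists_isTransgressionCocycle hM φ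
  rw [transgression_eq hM hc, Lam_simpleElement, H2mk_eq_iff] at hΛ
  obtain ⟨u, -, hu⟩ := hΛ
  obtain ⟨-, hyM, hy⟩ := hc
  -- The cochain `y` trivializes the inflated transgression and `u` accounts for the difference of
  -- the two cocycles on `G ⧸ M`, so `y + u` trivializes the pullback of the universal cocycle.
  have hcoc : ∀ σ τ : G, simpleCocycle p (ψ.1 σ, ψ'.1 σ) (ψ.1 τ, ψ'.1 τ) =
      (y σ + u σ) + (y τ + u τ) - (y (σ * τ) + u (σ * τ : G)) := by
    intro σ τ
    rw [← cupCocycle_add_bocksteinCocycle_apply, hu, hy, QuotientGroup.mk_mul]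
    ring
  -- On `M` the inflation of `u` is the constant `u 1`; its vanishing gives `y + u = φ` there.
  have hu1 : u 1 = 0 := by
    have h1 := hcoc 1 1
    have h2 : y 1 = 0 := (hyM 1).trans (H1_map_one φ.1)
    have h0 : ((0 : ZMod p), (0 : ZMod p)) = 0 := rfl
    rw [QuotientGroup.mk_one, H1_map_one, H1_map_one, h0, simpleCocycle_zero_left, mul_one, h2,
      QuotientGroup.mk_one] at h1
    linear_combination -h1
  let f : G →* SimpleExtension p := MonoidHom.mk' (fun σ => ⟨(ψ.1 σ, ψ'.1 σ), y σ + u σ⟩)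
    (fun σ τ => by
      ext1
      · simp only [SimpleExtension.base_mul, QuotientGroup.mk_mul, ψ.2.2, ψ'.2.2, Prod.mk_add_mk]
      · simp only [SimpleExtension.fibre_mul, hcoc]
        ring)
  have hbase : ∀ σ : G, (ψ.1 σ = 0 ∧ ψ'.1 σ = 0) ↔ σ ∈ M := by
    intro σ
    rw [← QuotientGroup.eq_one_iff, ← Subgroup.mem_bot, hK]
    rfl
  refine ⟨f, ?_⟩
  ext σ
  have hf : σ ∈ f.ker ↔ (ψ.1 σ = 0 ∧ ψ'.1 σ = 0) ∧ y σ + u σ = 0 := by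
    rw [MonoidHom.mem_ker, SimpleExtension.ext_iff]
    exact and_congr_left' Prod.ext_iff
  rw [hf, hbase]
  constructor
  · rintro ⟨hσ, h0⟩
    rw [(QuotientGroup.eq_one_iff σ).2 hσ, hu1, add_zero] at h0
    exact ⟨⟨σ, hσ⟩, (hyM ⟨σ, hσ⟩).symm.trans h0, rfl⟩
  · rintro ⟨m, hm, rfl⟩
    refine ⟨m.2, ?_⟩
    change y m + u (m : G) = 0
    rw [(QuotientGroup.eq_one_iff (m : G)).2 m.2, hu1, add_zero, hyM]
    exact hm

/-- The two base coordinates of `f` serve as `ψ, ψ'` and its fibre coordinate as the cochain `y`: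
multiplicativity of `f` is precisely the transgression identity. -/
theorem isDistinguished_ker (f : G →* SimpleExtension p) (hf : IsOpen (f.ker : Set G)) :
    IsDistinguished p f.ker := by
  -- Any function of `f σ` factors through the discrete group `G ⧸ f.ker`.
  have hcont : ∀ {X : Type} [TopologicalSpace X] (g : SimpleExtension p → X),
      Continuous fun σ => g (f σ) := by
    intro X _ g
    have := QuotientGroup.discreteTopology hf
    exact (continuous_of_discreteTopology
      (f := fun a => g (QuotientGroup.kerLift f a))).comp QuotientGroup.continuous_mk
  let M : Subgroup G := (SimpleExtension.baseHom.comp f).ker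
  have hmem : ∀ {σ : G}, σ ∈ M ↔ (f σ).base = 0 := Iff.rfl
  have hM : IsOpen (M : Set G) := Subgroup.isOpen_mono
    (fun σ hσ => by rw [hmem, MonoidHom.mem_ker.1 hσ]; rfl) hf
  have := QuotientGroup.discreteTopology hM
  let k : G ⧸ M →* Multiplicative (ZMod p × ZMod p) := QuotientGroup.kerLift _
  let ψ : H1 p (G ⧸ M) := ⟨fun a => (k a).toAdd.1, continuous_of_discreteTopology,
    fun a b => by simp only [map_mul]; rfl⟩
  let ψ' : H1 p (G ⧸ M) := ⟨fun a => (k a).toAdd.2, continuous_of_discreteTopology,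
    fun a b => by simp only [map_mul]; rfl⟩
  let y : G → ZMod p := fun σ => (f σ).fibre
  have hy : ∀ σ τ, simpleCocycle p (f σ).base (f τ).base = y σ + y τ - y (σ * τ) := by
    intro σ τ
    simp [y]
  let φ : invariantH1 p M := ⟨⟨fun m => y m, (hcont _).comp continuous_subtype_val,
    fun m n => by
      have := hy m n
      rw [hmem.1 m.2, simpleCocycle_zero_left] at this
      change y (m * n) = _
      linear_combination this⟩, fun g m => by
      change (f (g⁻¹ * m * g)).fibre = (f m).fibre
      rw [map_mul, map_mul, mul_assoc,
        SimpleExtension.mul_comm_of_base_eq_zero (hmem.1 m.2), ← mul_assoc, ← map_mul,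
        inv_mul_cancel, map_one, one_mul]⟩
  refine ⟨M, inferInstance, hM, φ, simpleElement ψ ψ', ⟨ψ, ψ', rfl, ?_⟩, ?_, ?_⟩
  · symm
    rw [eq_bot_iff]
    intro a ha
    exact QuotientGroup.kerLift_injective _
      ((Prod.ext ha.1 ha.2 : (k a).toAdd = 0).trans (congrArg Multiplicative.toAdd k.map_one).symm)
  · rw [Lam_simpleElement, transgression_eq hM (y := y) ⟨hcont _, fun _ => rfl, fun σ τ => ?_⟩]
    rw [cupCocycle_add_bocksteinCocycle_apply, ← hy]
    rfl
  · ext σ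
    rw [MonoidHom.mem_ker, SimpleExtension.ext_iff]
    constructor
    · rintro ⟨h1, h2⟩
      exact ⟨⟨σ, h1⟩, h2, rfl⟩
    · rintro ⟨m, hm, rfl⟩
      exact ⟨m.2, hm⟩

theorem isDistinguished_iff_exists_injective {N : Subgroup G} [N.Normal]
    (hN : IsOpen (N : Set G)) :
    IsDistinguished p N ↔ ∃ f : G ⧸ N →* SimpleExtension p, Function.Injective f := by
  constructor
  · intro h
    obtain ⟨f, rfl⟩ := h.exists_hom
    exact ⟨_, QuotientGroup.kerLift_injective f⟩
  · rintro ⟨f, hf⟩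
    have hker : (f.comp (QuotientGroup.mk' N)).ker = N := by
      rw [← MonoidHom.comap_ker, (MonoidHom.ker_eq_bot_iff f).2 hf, MonoidHom.comap_bot,
        QuotientGroup.ker_mk']
    rw [← hker] at hN
    exact hker ▸ isDistinguished_ker _ hN

end

/-! ### Classification of the subgroups of the extension -/

theorem nonempty_addEquiv_zmod_prod {p : ℕ} [hp : Fact p.Prime] {A : Type*} [AddCommGroup A]
    (hA : Nat.card A = p ^ 2) (hexp : ∀ x : A, p • x = 0) :
    Nonempty (A ≃+ ZMod p × ZMod p) := by
  have hfin : Finite A := Nat.finite_of_card_ne_zero (by simp [hA, hp.out.ne_zero])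
  obtain ⟨_⟩ : Nonempty (Module (ZMod p) A) := ⟨AddCommGroup.zmodModule hexp⟩
  have hrank : Module.finrank (ZMod p) A = 2 :=
    Nat.pow_right_injective hp.out.two_le
      ((FiniteField.pow_finrank_eq_natCard p A).trans hA)
  exact ⟨(LinearEquiv.ofFinrankEq (R := ZMod p) A (ZMod p × ZMod p) (by simp [hrank])).toAddEquiv⟩

/-- A group of order `p²` is abelian. If it is not cyclic, no element has order `p²`, so it is
killed by `p` and is a plane over the field `ZMod p`. -/
theorem nonempty_mulEquiv_of_card_eq_prime_sq {p : ℕ} [hp : Fact p.Prime] {Q : Type*} [Group Q]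
    (hQ : Nat.card Q = p ^ 2) :
    Nonempty (Q ≃* Multiplicative (ZMod p × ZMod p)) ∨
      Nonempty (Q ≃* Multiplicative (ZMod (p ^ 2))) := by
  by_cases hc : IsCyclic Q
  · exact .inr ⟨mulEquivOfCyclicCardEq (by simp [hQ])⟩
  left
  have hfin : Finite Q := Nat.finite_of_card_ne_zero (by simp [hQ, hp.out.ne_zero])
  let : CommGroup Q := IsPGroup.commGroupOfCardEqPrimeSq hQ
  have hexp : ∀ x : Q, x ^ p = 1 := by
    intro x
    have hdvd := orderOf_dvd_natCard x
    rw [hQ, Nat.dvd_prime_pow hp.out] at hdvd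
    obtain ⟨k, hk, hx⟩ := hdvd
    have hk2 : k ≠ 2 := by
      rintro rfl
      exact hc (isCyclic_of_orderOf_eq_card x (hx.trans hQ.symm))
    rw [← orderOf_dvd_iff_pow_eq_one, hx]
    exact (pow_dvd_pow p (by lia : k ≤ 1)).trans (pow_one p).dvd
  obtain ⟨e⟩ := nonempty_addEquiv_zmod_prod (A := Additive Q) hQ
    fun x => congrArg Additive.ofMul (hexp x.toMul)
  exact ⟨AddEquiv.toMultiplicativeRight e⟩

theorem exists_injective_simpleExtension_iff {p : ℕ} [hp : Fact p.Prime] {Q : Type*} [Group Q] :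
    (∃ f : Q →* SimpleExtension p, Function.Injective f) ↔
      Nonempty (Q ≃* Unit) ∨ Nonempty (Q ≃* Multiplicative (ZMod p)) ∨
        Nonempty (Q ≃* Multiplicative (ZMod p × ZMod p)) ∨
        Nonempty (Q ≃* Multiplicative (ZMod (p ^ 2))) ∨ Nonempty (Q ≃* SimpleExtension p) := by
  constructor
  · rintro ⟨f, hf⟩
    have hdvd := Subgroup.card_dvd_of_injective f hf
    rw [SimpleExtension.card_eq, Nat.dvd_prime_pow hp.out] at hdvd
    obtain ⟨k, hk, hQ⟩ := hdvd
    have := Finite.of_injective f hf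
    interval_cases k
    · have := (Nat.card_eq_one_iff_unique.1 (hQ.trans (pow_zero p))).1
      exact .inl ⟨⟨⟨fun _ => (), fun _ => 1, fun _ => Subsingleton.elim _ _, fun _ => rfl⟩,
        fun _ _ => rfl⟩⟩
    · rw [pow_one] at hQ
      have := isCyclic_of_prime_card hQ
      exact .inr (.inl ⟨mulEquivOfCyclicCardEq (by simp [hQ])⟩)
    · rcases nonempty_mulEquiv_of_card_eq_prime_sq hQ with h | h
      · exact .inr (.inr (.inl h))
      · exact .inr (.inr (.inr (.inl h)))
    · exact .inr (.inr (.inr (.inr ⟨MulEquiv.ofBijective f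
        ((Nat.bijective_iff_injective_and_card f).2
          ⟨hf, hQ.trans SimpleExtension.card_eq.symm⟩)⟩)))
  · have key : ∀ {R : Type} [Group R] (g : R →* SimpleExtension p), Function.Injective g →
        Q ≃* R → ∃ f : Q →* SimpleExtension p, Function.Injective f :=
      fun g hg e => ⟨g.comp e.toMonoidHom, hg.comp e.injective⟩
    rintro (⟨⟨e⟩⟩ | ⟨⟨e⟩⟩ | ⟨⟨e⟩⟩ | ⟨⟨e⟩⟩ | ⟨⟨e⟩⟩)
    · exact key 1 (Function.injective_of_subsingleton _) e
    · refine key (SimpleExtension.ofProd.comp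
        (AddMonoidHom.toMultiplicative (AddMonoidHom.inl (ZMod p) (ZMod p)))) ?_ e
      exact SimpleExtension.ofProd_injective.comp (Prod.mk_left_injective 0)
    · exact key _ SimpleExtension.ofProd_injective e
    · obtain ⟨x, hx⟩ := SimpleExtension.exists_orderOf_eq p
      have e' : Multiplicative (ZMod (p ^ 2)) ≃* Subgroup.zpowers x :=
        mulEquivOfCyclicCardEq (by rw [Nat.card_zpowers, hx]; simp)
      exact key ((Subgroup.zpowers x).subtype.comp e'.toMonoidHom)
        (Subtype.val_injective.comp e'.injective) e
    · exact key (MonoidHom.id _) Function.injective_id e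

/-! ### Identification with `D₄` for `p = 2` -/

/-- The map sending the generators of `D₄` to elements of orders `4` and `2`. -/
def dihedralToSimpleExtension : DihedralGroup 4 → SimpleExtension 2
  | .r i => (⟨(1, 1), 0⟩ : SimpleExtension 2) ^ i.val
  | .sr i => (⟨(0, 1), 0⟩ : SimpleExtension 2) * (⟨(1, 1), 0⟩ : SimpleExtension 2) ^ i.val

theorem dihedralToSimpleExtension_mul (x y : DihedralGroup 4) :
    dihedralToSimpleExtension (x * y) =
      dihedralToSimpleExtension x * dihedralToSimpleExtension y := by
  revert x y
  decide

theorem dihedralToSimpleExtension_injective : Function.Injective dihedralToSimpleExtension := by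
  intro x y
  revert x y
  decide

theorem nonempty_dihedralGroup_mulEquiv : Nonempty (DihedralGroup 4 ≃* SimpleExtension 2) :=
  ⟨MulEquiv.ofBijective (MonoidHom.mk' _ dihedralToSimpleExtension_mul)
    ((Nat.bijective_iff_injective_and_card _).2 ⟨dihedralToSimpleExtension_injective, by
      rw [DihedralGroup.nat_card, SimpleExtension.card_eq]; rfl⟩)⟩

/-! ### Identification with `M_{p³}` for `p ≠ 2` -/

section Modular

variable {p : ℕ}

theorem modularGroup_rel (p : ℕ) {w : FreeGroup (Fin 2)} (hw : w ∈ modularRels p) :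
    (PresentedGroup.mk (modularRels p) w) = 1 :=
  (QuotientGroup.eq_one_iff _).2 (Subgroup.subset_normalClosure hw)

/-- The commutator relation reads `s⁻¹ r s = r ^ (p + 1)`, so every `s` can be moved to the left
past powers of `r`. -/
theorem ModularGroup.exists_normal_form (hp : p ≠ 0) (x : ModularGroup p) :
    ∃ j i : ℕ, x = PresentedGroup.of 1 ^ j * PresentedGroup.of 0 ^ i := by
  set r : ModularGroup p := PresentedGroup.of 0 with hr
  set s : ModularGroup p := PresentedGroup.of 1 with hs
  have hrp : r ^ (p ^ 2) = 1 := modularGroup_rel p (w := FreeGroup.of 0 ^ (p ^ 2)) (by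
    simp [modularRels])
  have hsp : s ^ p = 1 := modularGroup_rel p (w := FreeGroup.of 1 ^ p) (by simp [modularRels])
  have hrs : r⁻¹ * s⁻¹ * r * s * (r ^ p)⁻¹ = 1 := modularGroup_rel p
    (w := ((FreeGroup.of 0)⁻¹ * (FreeGroup.of 1)⁻¹ * FreeGroup.of 0 * FreeGroup.of 1)
      * (FreeGroup.of 0 ^ p)⁻¹) (by simp [modularRels])
  have hconj : s⁻¹ * r * s = r ^ (p + 1) := by
    rw [mul_inv_eq_one] at hrs
    rw [pow_succ', ← hrs]
    group
  have hstep : ∀ i : ℕ, r ^ i * s = s * r ^ ((p + 1) * i) := by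
    intro i
    have := conj_pow (a := s⁻¹) (b := r) (i := i)
    rw [inv_inv] at this
    rw [pow_mul, ← hconj, this]
    group
  -- Both generators have finite order, so their inverses are positive powers and only right
  -- multiplication by `r` or `s` has to be treated.
  have hx : x ∈ Submonoid.closure ({r, s} : Set (ModularGroup p)) := by
    have hinv : ∀ n z, z ∈ ({r, s} : Set (ModularGroup p)) → n ≠ 0 → z ^ n = 1 →
        z⁻¹ ∈ Submonoid.closure ({r, s} : Set (ModularGroup p)) := by
      intro n z hz hn h
      rw [inv_eq_of_mul_eq_one_right (b := z ^ (n - 1)) (by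
        rw [← pow_succ', Nat.sub_add_cancel (Nat.one_le_iff_ne_zero.2 hn), h])]
      exact pow_mem (Submonoid.subset_closure hz) _
    have htop : x ∈ Subgroup.closure ({r, s} : Set (ModularGroup p)) := by
      refine PresentedGroup.generated_by _ _ (fun j => ?_) x
      fin_cases j
      · exact Subgroup.subset_closure (by simp [hr])
      · exact Subgroup.subset_closure (by simp [hs])
    rw [← Subgroup.mem_toSubmonoid, Subgroup.closure_toSubmonoid] at htop
    refine Submonoid.closure_le.2 ?_ htop
    rintro z (hz | hz)
    · exact Submonoid.subset_closure hz
    · rcases hz with hz | hz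
      · rw [← inv_inv z, hz]
        exact hinv (p ^ 2) r (by simp) (pow_ne_zero 2 hp) hrp
      · rw [← inv_inv z, Set.mem_singleton_iff.1 hz]
        exact hinv p s (by simp) hp hsp
  induction hx using Submonoid.closure_induction_right with
  | one => exact ⟨0, 0, by simp⟩
  | mul_right z _ w hw ih =>
    obtain ⟨j, i, rfl⟩ := ih
    rcases hw with rfl | hw
    · exact ⟨j, i + 1, by rw [pow_succ, mul_assoc]⟩
    · rw [Set.mem_singleton_iff] at hw
      subst hw
      exact ⟨j + 1, (p + 1) * i, by rw [mul_assoc, hstep, pow_succ, mul_assoc]⟩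

/-- Reducing the exponents of the normal form bounds the order of the presented group by `p³`; this
makes the surjection onto the extension bijective. -/
theorem ModularGroup.exists_surjective (hp : p ≠ 0) :
    ∃ f : Fin p × Fin (p ^ 2) → ModularGroup p, Function.Surjective f := by
  refine ⟨fun x => PresentedGroup.of 1 ^ (x.1 : ℕ) * PresentedGroup.of 0 ^ (x.2 : ℕ), fun x => ?_⟩
  have hr : (PresentedGroup.of 0 : ModularGroup p) ^ (p ^ 2) = 1 :=
    modularGroup_rel p (w := FreeGroup.of 0 ^ (p ^ 2)) (by simp [modularRels])
  have hs : (PresentedGroup.of 1 : ModularGroup p) ^ p = 1 :=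
    modularGroup_rel p (w := FreeGroup.of 1 ^ p) (by simp [modularRels])
  obtain ⟨j, i, rfl⟩ := ModularGroup.exists_normal_form hp x
  refine ⟨(⟨j % p, Nat.mod_lt _ (Nat.pos_of_ne_zero hp)⟩,
    ⟨i % p ^ 2, Nat.mod_lt _ (pow_pos (Nat.pos_of_ne_zero hp) 2)⟩), ?_⟩
  change _ ^ (j % p) * _ ^ (i % p ^ 2) = _
  rw [← pow_eq_pow_mod _ hs, ← pow_eq_pow_mod _ hr]

theorem nonempty_modularGroup_mulEquiv [hp : Fact p.Prime] (hp2 : p ≠ 2) :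
    Nonempty (ModularGroup p ≃* SimpleExtension p) := by
  let g : Fin 2 → SimpleExtension p := ![⟨(1, 0), 0⟩, ⟨(0, 1), 0⟩]
  have hrp : (⟨(1, 0), 0⟩ : SimpleExtension p) ^ p = ⟨0, -1⟩ :=
    SimpleExtension.pow_first_self hp.out.one_lt hp2
  have hg : ∀ w ∈ modularRels p, FreeGroup.lift g w = 1 := by
    rintro w (rfl | rfl | rfl)
    · simp only [map_pow, FreeGroup.lift_apply_of, g, Matrix.cons_val_zero]
      rw [sq, pow_mul, hrp, SimpleExtension.pow_of_base_eq_zero rfl]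
      ext1 <;> simp
    · simp only [map_pow, FreeGroup.lift_apply_of, g, Matrix.cons_val_one]
      -- The image of `s` lies in the subgroup `(ℤ/p)²` given by `ofProd`, which has exponent `p`.
      have := map_pow (SimpleExtension.ofProd (p := p)) (Multiplicative.ofAdd (1, 0)) p
      rw [← ofAdd_nsmul] at this
      refine this.symm.trans ?_
      simp only [Prod.smul_mk, nsmul_eq_mul, mul_one, mul_zero, CharP.cast_eq_zero]
      exact map_one _
    · simp only [map_mul, map_inv, map_pow, FreeGroup.lift_apply_of, g, Matrix.cons_val_zero,
        Matrix.cons_val_one]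
      -- The relation becomes `r s = s r ⟨0, -1⟩`. It holds since the cocycle is `1` on the bases of
      -- `(r, s)` and `0` on those of `(s, r)`.
      rw [hrp, mul_inv_eq_one, mul_assoc, ← mul_inv_rev, inv_mul_eq_iff_eq_mul]
      ext1 <;> simp [simpleCocycle, carry_zero_left, carry_zero_right]
  let f : ModularGroup p →* SimpleExtension p := PresentedGroup.toGroup hg
  have hf0 : f (PresentedGroup.of 0) = ⟨(1, 0), 0⟩ := PresentedGroup.toGroup.of hg
  have hf1 : f (PresentedGroup.of 1) = ⟨(0, 1), 0⟩ := PresentedGroup.toGroup.of hg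
  have hsurj : Function.Surjective f := by
    intro x
    let z : ModularGroup p :=
      PresentedGroup.of 1 ^ x.base.2.val * PresentedGroup.of 0 ^ x.base.1.val
    have hz : (f z).base = x.base := by
      simp [z, hf0, hf1, SimpleExtension.base_pow]
    have hw : ((f z)⁻¹ * x).base = 0 := by
      rw [SimpleExtension.base_mul, SimpleExtension.base_inv, hz, neg_add_cancel]
    -- `z` already has the right base. The remaining central factor is a power of `f (r ^ p) = ⟨0,
    -- -1⟩`, whose sign explains the negated exponent.
    refine ⟨z * (PresentedGroup.of 0 ^ p) ^ (-((f z)⁻¹ * x).fibre).val, ?_⟩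
    rw [map_mul, map_pow, map_pow, hf0, hrp, SimpleExtension.pow_of_base_eq_zero rfl,
      ← eq_inv_mul_iff_mul_eq]
    ext1
    · exact hw.symm
    · simp only [ZMod.natCast_val, ZMod.cast_id, mul_neg, mul_one, neg_neg]
  obtain ⟨t, ht⟩ := ModularGroup.exists_surjective hp.out.ne_zero
  have hfin : Finite (ModularGroup p) := Finite.of_surjective t ht
  have hle : Nat.card (ModularGroup p) ≤ p ^ 3 := by
    refine (Nat.card_le_card_of_surjective t ht).trans_eq ?_
    simp only [Nat.card_prod, Nat.card_fin]
    ring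
  have hge := Nat.card_le_card_of_surjective f hsurj
  rw [SimpleExtension.card_eq] at hge
  exact ⟨MulEquiv.ofBijective f ((Nat.bijective_iff_surjective_and_card f).2
    ⟨hsurj, (hle.antisymm hge).trans SimpleExtension.card_eq.symm⟩)⟩

end Modular

end ProfiniteCohomology

theorem theorem11p1 (p : ℕ) [hp : Fact p.Prime] {G : Type*} [Group G] [TopologicalSpace G]
    [IsTopologicalGroup G] [CompactSpace G] [TotallyDisconnectedSpace G]
    (N : Subgroup G) [N.Normal] (hN : IsOpen (N : Set G)) :
    ProfiniteCohomology.IsDistinguished p N ↔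
      ((p = 2 →
          Nonempty (G ⧸ N ≃* Unit) ∨
          Nonempty (G ⧸ N ≃* Multiplicative (ZMod 2)) ∨
          Nonempty (G ⧸ N ≃* Multiplicative (ZMod 2 × ZMod 2)) ∨
          Nonempty (G ⧸ N ≃* Multiplicative (ZMod 4)) ∨
          Nonempty (G ⧸ N ≃* DihedralGroup 4)) ∧
        (p ≠ 2 →
          Nonempty (G ⧸ N ≃* Unit) ∨
          Nonempty (G ⧸ N ≃* Multiplicative (ZMod p)) ∨
          Nonempty (G ⧸ N ≃* Multiplicative (ZMod p × ZMod p)) ∨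
          Nonempty (G ⧸ N ≃* Multiplicative (ZMod (p ^ 2))) ∨
          Nonempty (G ⧸ N ≃* ProfiniteCohomology.ModularGroup p))) := by
  rw [ProfiniteCohomology.isDistinguished_iff_exists_injective hN,
    ProfiniteCohomology.exists_injective_simpleExtension_iff]
  by_cases h2 : p = 2
  · subst h2
    obtain ⟨e⟩ := ProfiniteCohomology.nonempty_dihedralGroup_mulEquiv
    have he : Nonempty (G ⧸ N ≃* ProfiniteCohomology.SimpleExtension 2) ↔
        Nonempty (G ⧸ N ≃* DihedralGroup 4) :=
      ⟨fun ⟨f⟩ => ⟨f.trans e.symm⟩, fun ⟨f⟩ => ⟨f.trans e⟩⟩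
    rw [he]
    exact ⟨fun h => ⟨fun _ => h, fun h' => absurd rfl h'⟩, fun h => h.1 rfl⟩
  · obtain ⟨e⟩ := ProfiniteCohomology.nonempty_modularGroup_mulEquiv h2
    have he : Nonempty (G ⧸ N ≃* ProfiniteCohomology.SimpleExtension p) ↔
        Nonempty (G ⧸ N ≃* ProfiniteCohomology.ModularGroup p) :=
      ⟨fun ⟨f⟩ => ⟨f.trans e.symm⟩, fun ⟨f⟩ => ⟨f.trans e⟩⟩
    rw [he]
    exact ⟨fun h => ⟨fun h' => absurd h' h2, fun _ => h⟩, fun h => h.2 h2⟩
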